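/- **Setting.** Consider the plant $\dot x=f(x)+Bu+Ed$ with $x\in\mathbb R^n$, $u\in\mathbb R^m$, $d\in\mathbb R^q$. Assume that $f(x)=AZ(x)$ for all $x$, where $A\in\mathbb R^{n\times s}$ and $Z(x)=\begin{bmatrix}x\\Q(x)\end{bmatrix}\in\mathbb R^s$ with $Q:\mathbb R^n\to\mathbb R^{s-n}$ continuously differentiable. Let $R_Q\in\mathbb R^{n\times\tau}$ satisfy $\frac{\partial Q}{\partial x}(x)^\top\frac{\partial Q}{\partial x}(x)\preceq R_QR_Q^\top$ for all $x\in\mathbb R^n$. Let $\delta>0$, and call a signal $d:\mathbb R\to\mathbb R^q$ admissible if it is continuous and $|d(t)|\le\delta$ for all $t\in\mathbb R$ (here $|\cdot|$ is the 2-norm). In an experiment on the plant, $x_i=x(t_i)$, $u_i=u(t_i)$ and $\dot x_i=\dot x(t_i)$ are recorded at times $0\le t_0<\dots<t_{T-1}$, where $T\ge 1$. The (unknown) disturbance samples $d_i=d(t_i)$ satisfy $|d_i|\le\delta$, so that $\dot x_i=f(x_i)+Bu_i+Ed_i$. Put $U_0=[u_0\,\cdots\,u_{T-1}]$, $X_1=[\dot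 x_0\,\cdots\,\dot x_{T-1}]$ and $Z_0=[Z(x_0)\,\cdots\,Z(x_{T-1})]$. Let the symmetric matrix $P\in\mathbb R^{n\times n}$, $Y_1\in\mathbb R^{T\times n}$, $G_2\in\mathbb R^{T\times(s-n)}$, $\alpha>0$ and $\mu>0$ satisfy, with $\Delta=\delta\sqrt T\,I_q$, $$P\succ0,\qquad Z_0Y_1=\begin{bmatrix}P\\0\end{bmatrix},\qquad Z_0G_2=\begin{bmatrix}0\\I_{s-n}\end{bmatrix},$$ $$\begin{bmatrix}X_1Y_1+(X_1Y_1)^\top+\alpha I_n+\mu E\Delta\Delta^\top E^\top&\star&\star&\star\\ G_2^\top X_1^\top&-I_{s-n}&\star&\star\\ R_Q^\top P&0&-I_\tau&\star\\ Y_1&G_2&0&-\mu I_T\end{bmatrix}\preceq0,$$ where $\star$ denotes the blocks determined by symmetry. Let $K=U_0\begin{bmatrix}Y_1P^{-1}&G_2\end{bmatrix}$. **Claim.** For every admissible $d$, the closed-loop system $\dot x=(A+BK)Z(x)+Ed(t)$ is convergent, that is: 1. for all $t_0\in\mathbb R$ and $x(t_0)\in\mathbb R^n$, its solutions are defined for all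 $t\ge t_0$; 2. there is a unique solution $x_*$ that is defined and bounded on all of $\mathbb R$; 3. $x_*$ is globally uniformly exponentially stable: there are $c,\lambda>0$ such that $|x(t)-x_*(t)|\le c\,e^{-\lambda(t-t_0)}|x(t_0)-x_*(t_0)|$ for all $t_0\in\mathbb R$, all $t\ge t_0$ and every solution $x$ on $[t_0,\infty)$. If $d$ is periodic with period $\theta>0$, then so is $x_*$. If $d$ is constant, then $x_*$ is constant. Finally, for every admissible $d$ there exist a $\mathcal{KL}$ function $\hat\beta$ and a $\mathcal K_\infty$ function $\hat\gamma$ such that, for every continuous bounded input $w:[0,\infty)\to\mathbb R^n$, the solutions of $\dot x=(A+BK)Z(x)+Ed(t)+w(t)$ from any $x(0)\in\mathbb R^n$ are defined for all $t\ge0$ and satisfy $$|x(t)-x_*(t)|\le\hat\beta\bigl(|x(0)-x_*(0)|,t\bigr)+\hat\gamma\Bigl(\sup_{0\le\sigma\le t}|w(\sigma)|\Bigr)\qquad\text{for all }t\ge0.$$ -/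

import Mathlib

open Set Filter Topology
open scoped Matrix

noncomputable section

namespace DataControl

/-- `ℝᵏ` with the 2-norm. -/
abbrev Vec (ι : Type) [Fintype ι] : Type := EuclideanSpace ℝ ι

/-- The matrix-vector product `M v`, with values in the Euclidean space. -/
def mulV {ι κ : Type} [Fintype ι] [Fintype κ] (M : Matrix ι κ ℝ) (v : Vec κ) : Vec ι :=
  WithLp.toLp 2 (M *ᵥ v.ofLp)

/-! ### Systems `ẋ = v(t, x)` -/

section Systems

variable {n : ℕ}

/-- From the initial time `t₀` on, the system `ẋ = v(t, x)` has, for every initial value, a solution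
defined on `[t₀, ∞)`, and no solution escapes in finite time: each solution on some `[t₀, b)` is
the restriction of a solution on `[t₀, ∞)`. -/
def ForwardCompleteFrom (v : ℝ → Vec (Fin n) → Vec (Fin n)) (t₀ : ℝ) : Prop :=
  ∀ x₀ : Vec (Fin n),
    (∃ x : ℝ → Vec (Fin n), x t₀ = x₀ ∧ IsIntegralCurveOn x v (Ici t₀)) ∧
    ∀ b : ℝ, t₀ < b → ∀ y : ℝ → Vec (Fin n), y t₀ = x₀ → IsIntegralCurveOn y v (Ico t₀ b) →
      ∃ x : ℝ → Vec (Fin n), IsIntegralCurveOn x v (Ici t₀) ∧ EqOn x y (Ico t₀ b)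

/-- `x` is a solution of `ẋ = v(t, x)` that is defined and bounded on all of `ℝ`. -/
def IsBoundedSolution (v : ℝ → Vec (Fin n) → Vec (Fin n)) (x : ℝ → Vec (Fin n)) : Prop :=
  IsIntegralCurve x v ∧ ∃ C : ℝ, ∀ t : ℝ, ‖x t‖ ≤ C

/-- The solution `xs` is globally uniformly exponentially stable: overshoot and rate
depend neither on the initial time nor on the initial value. -/
def IsGUES (v : ℝ → Vec (Fin n) → Vec (Fin n)) (xs : ℝ → Vec (Fin n)) : Prop :=
  ∃ c > (0 : ℝ), ∃ lam > (0 : ℝ), ∀ t₀ : ℝ, ∀ x : ℝ → Vec (Fin n),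
    IsIntegralCurveOn x v (Ici t₀) →
      ∀ t : ℝ, t₀ ≤ t → ‖x t - xs t‖ ≤ c * Real.exp (-lam * (t - t₀)) * ‖x t₀ - xs t₀‖

/-- Convergent systems. -/
def IsConvergent (v : ℝ → Vec (Fin n) → Vec (Fin n)) : Prop :=
  (∀ t₀ : ℝ, ForwardCompleteFrom v t₀) ∧
  ∃ xs : ℝ → Vec (Fin n),
    (IsBoundedSolution v xs ∧ ∀ y : ℝ → Vec (Fin n), IsBoundedSolution v y → y = xs) ∧
    IsGUES v xs

end Systems

/-! ### Comparison functions (on `[0, ∞)`) -/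

/-- Class `𝒦`. -/
def IsClassK (g : ℝ → ℝ) : Prop :=
  g 0 = 0 ∧ ContinuousOn g (Ici 0) ∧ StrictMonoOn g (Ici 0)

/-- Class `𝒦_∞`. -/
def IsClassKInfty (g : ℝ → ℝ) : Prop :=
  IsClassK g ∧ Tendsto g atTop atTop

/-- Class `𝒦ℒ`. -/
def IsClassKL (b : ℝ → ℝ → ℝ) : Prop :=
  ContinuousOn (Function.uncurry b) (Ici 0 ×ˢ Ici 0) ∧
  (∀ t : ℝ, 0 ≤ t → IsClassK (fun r => b r t)) ∧
  (∀ r : ℝ, 0 ≤ r → AntitoneOn (b r) (Ici 0) ∧ Tendsto (b r) atTop (𝓝 0))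

/-! ### The plant, the data and the semidefinite program -/

section Plant

variable {n m r q τ T : ℕ}

/-- The dictionary `Z(x) = [x; Q(x)]`, where `Q` has `r = s - n` components. -/
def dict (Q : Vec (Fin n) → Vec (Fin r)) (x : Vec (Fin n)) : Vec (Fin n ⊕ Fin r) :=
  WithLp.toLp 2 (Sum.elim x.ofLp (Q x).ofLp)

/-- The Jacobian matrix `∂Q/∂x (x)`. -/
def jacobian (Q : Vec (Fin n) → Vec (Fin r)) (x : Vec (Fin n)) : Matrix (Fin r) (Fin n) ℝ :=
  Matrix.of fun i j => fderiv ℝ Q x (EuclideanSpace.single j 1) i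

/-- An experiment on the plant `ẋ = f(x) + B u + E d`: signals `x`, `u`, `d`, sampled together with
`ẋ` at the times `0 ≤ t_0 < … < t_{T-1}`, where the signals obey the plant equation at the sampling
times. (The derivative is only asked for from the right, so that the initial time and switching
times of the input may be sampled.) -/
structure Experiment (f : Vec (Fin n) → Vec (Fin n)) (B : Matrix (Fin n) (Fin m) ℝ)
    (E : Matrix (Fin n) (Fin q) ℝ) (T : ℕ) where
  time : Fin T → ℝ
  time_nonneg : ∀ i, 0 ≤ time i
  time_strictMono : StrictMono time
  state : ℝ → Vec (Fin n)
  input : ℝ → Vec (Fin m)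
  disturbance : ℝ → Vec (Fin q)
  velocity : Fin T → Vec (Fin n)
  hasDeriv : ∀ i, HasDerivWithinAt state (velocity i) (Ici (time i)) (time i)
  plant : ∀ i, velocity i =
    f (state (time i)) + mulV B (input (time i)) + mulV E (disturbance (time i))

namespace Experiment

variable {f : Vec (Fin n) → Vec (Fin n)} {B : Matrix (Fin n) (Fin m) ℝ}
  {E : Matrix (Fin n) (Fin q) ℝ}

/-- `U₀ = [u_0 … u_{T-1}]`. -/
def U0 (e : Experiment f B E T) : Matrix (Fin m) (Fin T) ℝ :=
  Matrix.of fun i k => e.input (e.time k) i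

/-- `X₁ = [ẋ_0 … ẋ_{T-1}]`. -/
def X1 (e : Experiment f B E T) : Matrix (Fin n) (Fin T) ℝ :=
  Matrix.of fun i k => e.velocity k i

/-- `Z₀ = [Z(x_0) … Z(x_{T-1})]`. -/
def Z0 (e : Experiment f B E T) (Q : Vec (Fin n) → Vec (Fin r)) :
    Matrix (Fin n ⊕ Fin r) (Fin T) ℝ :=
  Matrix.of fun i k => dict Q (e.state (e.time k)) i

end Experiment

/-- The symmetric block matrix of the linear matrix inequality, with block rows and columns of sizes
`n`, `r`, `τ`, `T`:
```
[ X₁Y₁ + (X₁Y₁)ᵀ + αI + μEΔΔᵀEᵀ    ⋆     ⋆     ⋆  ]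
[ G₂ᵀX₁ᵀ                          -I     ⋆     ⋆  ]
[ R_QᵀP                            0    -I     ⋆  ]
[ Y₁                               G₂    0   -μI  ]
``` -/
def lmiMatrix (X₁ : Matrix (Fin n) (Fin T) ℝ) (E : Matrix (Fin n) (Fin q) ℝ)
    (Δ : Matrix (Fin q) (Fin q) ℝ) (R : Matrix (Fin n) (Fin τ) ℝ)
    (P : Matrix (Fin n) (Fin n) ℝ) (Y₁ : Matrix (Fin T) (Fin n) ℝ)
    (G₂ : Matrix (Fin T) (Fin r) ℝ) (α μ : ℝ) :
    Matrix ((Fin n ⊕ Fin r) ⊕ (Fin τ ⊕ Fin T)) ((Fin n ⊕ Fin r) ⊕ (Fin τ ⊕ Fin T)) ℝ :=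
  Matrix.fromBlocks
    (Matrix.fromBlocks
      (X₁ * Y₁ + (X₁ * Y₁)ᵀ + α • (1 : Matrix (Fin n) (Fin n) ℝ) + μ • (E * Δ * Δᵀ * Eᵀ))
      (G₂ᵀ * X₁ᵀ)ᵀ
      (G₂ᵀ * X₁ᵀ)
      (-1))
    (Matrix.fromBlocks (Rᵀ * P)ᵀ Y₁ᵀ 0 G₂ᵀ)
    (Matrix.fromBlocks (Rᵀ * P) 0 Y₁ G₂)
    (Matrix.fromBlocks (-1) 0 0 (-(μ • (1 : Matrix (Fin T) (Fin T) ℝ))))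

/-- `(P, Y₁, G₂, α, μ)` is a feasible point of the semidefinite program. -/
structure IsFeasible (X₁ : Matrix (Fin n) (Fin T) ℝ) (Z₀ : Matrix (Fin n ⊕ Fin r) (Fin T) ℝ)
    (E : Matrix (Fin n) (Fin q) ℝ) (Δ : Matrix (Fin q) (Fin q) ℝ) (R : Matrix (Fin n) (Fin τ) ℝ)
    (P : Matrix (Fin n) (Fin n) ℝ) (Y₁ : Matrix (Fin T) (Fin n) ℝ)
    (G₂ : Matrix (Fin T) (Fin r) ℝ) (α μ : ℝ) : Prop where
  alpha_pos : 0 < α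
  mu_pos : 0 < μ
  posDef : P.PosDef
  eq_left : Z₀ * Y₁ = Matrix.fromRows P 0
  lmi : (-(lmiMatrix X₁ E Δ R P Y₁ G₂ α μ)).PosSemidef
  eq_right : Z₀ * G₂ = Matrix.fromRows 0 1

/-- The gain `K = U₀ [Y₁P⁻¹  G₂]`. -/
def gain (U₀ : Matrix (Fin m) (Fin T) ℝ) (P : Matrix (Fin n) (Fin n) ℝ)
    (Y₁ : Matrix (Fin T) (Fin n) ℝ) (G₂ : Matrix (Fin T) (Fin r) ℝ) :
    Matrix (Fin m) (Fin n ⊕ Fin r) ℝ :=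
  U₀ * Matrix.fromCols (Y₁ * P⁻¹) G₂

/-- The right-hand side of the closed loop `ẋ = (A + BK) Z(x) + E d(t)`. -/
def closedLoop (A : Matrix (Fin n) (Fin n ⊕ Fin r) ℝ) (B : Matrix (Fin n) (Fin m) ℝ)
    (E : Matrix (Fin n) (Fin q) ℝ) (Q : Vec (Fin n) → Vec (Fin r))
    (K : Matrix (Fin m) (Fin n ⊕ Fin r) ℝ) (d : ℝ → Vec (Fin q)) :
    ℝ → Vec (Fin n) → Vec (Fin n) :=
  fun t x => mulV (A + B * K) (dict Q x) + mulV E (d t)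

end Plant

end DataControl

end

open DataControl


/-!
The data satisfy `X₁ = A Z₀ + B U₀ + E D₀` with unknown disturbance samples `D₀`, so the constraints
on `Z₀ Y₁` and `Z₀ G₂` give `A + B K = (X₁ - E D₀) [Y₁P⁻¹  G₂]`. The quadratic form of the linear
matrix inequality, evaluated at `(u, a, RᵀPu, -D₀ᵀEᵀu)`, eliminates `D₀` by means of `D₀D₀ᵀ ⪯ ΔΔᵀ`
alone and yields `2⟪P⁻¹(x - y), v(t, x) - v(t, y)⟫ ≤ -α ‖P⁻¹(x - y)‖²` for the closed-loop vector
field `v`: along the segment from `y` to `x` the Jacobian of `Q` obeys the bound that the block of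
`R` encodes. Hence `⟪P⁻¹(x - y), x - y⟫` is an incremental Lyapunov function, and with an additive
input Young's inequality and Grönwall's lemma give incremental exponential input-to-state
stability. Everything else follows from this one estimate: the solutions that start at the origin
at time `-k` converge, as `k → ∞`, to a bounded solution; bounded solutions are unique, hence
inherit the periods of `d`; and the estimate with input `w` is the required `𝒦ℒ`-`𝒦_∞` bound.
Solutions exist for all times because `v` is Lipschitz in the state, uniformly in time.
-/

namespace DataControl

section GlobalExistence

open scoped NNReal

/-- The weight `exp (∫_{t₀}^t a)`, with logarithmic derivative `a`. It measures the growth that the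
solutions of `ẋ = v(t, x)` may have when `a` dominates `v`. -/
noncomputable def expWeight (a : ℝ → ℝ) (t₀ t : ℝ) : ℝ :=
  Real.exp (∫ s in t₀..t, a s)

variable {a : ℝ → ℝ} {t₀ t : ℝ}

lemma expWeight_pos : 0 < expWeight a t₀ t := Real.exp_pos _

@[simp]
lemma expWeight_self : expWeight a t₀ t₀ = 1 := by simp [expWeight]

lemma one_le_expWeight (ha : ∀ s, 0 ≤ a s) (ht : t₀ ≤ t) : 1 ≤ expWeight a t₀ t :=
  Real.one_le_exp (intervalIntegral.integral_nonneg ht fun s _ => ha s)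

lemma hasDerivAt_expWeight (ha : Continuous a) :
    HasDerivAt (expWeight a t₀) (expWeight a t₀ t * a t) t :=
  (ha.integral_hasStrictDerivAt t₀ t).hasDerivAt.exp

@[fun_prop]
lemma continuous_expWeight (ha : Continuous a) : Continuous (expWeight a t₀) :=
  continuous_iff_continuousAt.2 fun _ => (hasDerivAt_expWeight ha).continuousAt

lemma integral_expWeight_mul (ha : Continuous a) :
    ∫ s in t₀..t, expWeight a t₀ s * a s = expWeight a t₀ t - 1 := by
  rw [intervalIntegral.integral_eq_sub_of_hasDerivAt (fun s _ => hasDerivAt_expWeight ha)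
    (Continuous.intervalIntegrable (by fun_prop) _ _), expWeight_self]

variable {F : Type*} [NormedAddCommGroup F] [NormedSpace ℝ F]

lemma norm_integral_le_mul_expWeight (ha : Continuous a) {f : ℝ → F} {c : ℝ} (hc : 0 ≤ c)
    (ht : t₀ ≤ t) (hf : ∀ s, t₀ ≤ s → ‖f s‖ ≤ c * (expWeight a t₀ s * a s)) :
    ‖∫ s in t₀..t, f s‖ ≤ c * expWeight a t₀ t :=
  calc ‖∫ s in t₀..t, f s‖ ≤ ∫ s in t₀..t, c * (expWeight a t₀ s * a s) :=
        intervalIntegral.norm_integral_le_of_norm_le ht (.of_forall fun s hs => hf s hs.1.le)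
          (Continuous.intervalIntegrable (by fun_prop) _ _)
    _ = c * (expWeight a t₀ t - 1) := by
        rw [intervalIntegral.integral_const_mul, integral_expWeight_mul ha]
    _ ≤ c * expWeight a t₀ t := by gcongr; exact sub_le_self _ zero_le_one

/-- The Picard operator of `ẋ = v(t, x)`, `x(t₀) = x₀`, for functions written as `ω • z`. A suitable
weight `ω` makes it a contraction for the supremum norm. Times before `t₀` are replaced by `t₀`, so
that it acts on functions on all of `ℝ`. -/
noncomputable def weightedPicard (v : ℝ → F → F) (ω : ℝ → ℝ) (t₀ : ℝ) (x₀ : F) (z : ℝ → F)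
    (t : ℝ) : F :=
  (ω (max t t₀))⁻¹ • (x₀ + ∫ s in t₀..max t t₀, v s (ω s • z s))

variable {v : ℝ → F → F} {x₀ : F} {K : ℝ≥0} {z z' : ℝ → F}

lemma continuous_weightedPicard (hv : Continuous (Function.uncurry v)) (ha : Continuous a)
    (hz : Continuous z) : Continuous (weightedPicard v (expWeight a t₀) t₀ x₀ z) := by
  have hmax : Continuous fun t : ℝ => max t t₀ := by fun_prop
  have hint : Continuous fun t => ∫ s in t₀..t, v s (expWeight a t₀ s • z s) :=
    intervalIntegral.continuous_primitive (fun _ _ => Continuous.intervalIntegrable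
      (hv.comp (by fun_prop : Continuous fun s => (s, expWeight a t₀ s • z s))) _ _) t₀
  exact (((continuous_expWeight ha).comp hmax).inv₀ fun _ => expWeight_pos.ne').smul
    (continuous_const.add (hint.comp hmax))

lemma norm_weightedPicard_zero_le (ha : Continuous a) (hva : ∀ s, ‖v s 0‖ ≤ a s) (t : ℝ) :
    ‖weightedPicard v (expWeight a t₀) t₀ x₀ 0 t‖ ≤ ‖x₀‖ + 1 := by
  have ha0 : ∀ s, 0 ≤ a s := fun s => (norm_nonneg _).trans (hva s)
  have ht : t₀ ≤ max t t₀ := le_max_right _ _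
  have hint : ‖∫ s in t₀..max t t₀, v s 0‖ ≤ 1 * expWeight a t₀ (max t t₀) :=
    norm_integral_le_mul_expWeight ha zero_le_one ht fun s hs => by
      rw [one_mul]
      exact (hva s).trans (le_mul_of_one_le_left (ha0 s) (one_le_expWeight ha0 hs))
  have hx₀ : ‖x₀‖ ≤ ‖x₀‖ * expWeight a t₀ (max t t₀) :=
    le_mul_of_one_le_right (norm_nonneg _) (one_le_expWeight ha0 ht)
  simp only [weightedPicard, Pi.zero_apply, smul_zero]
  rw [norm_smul_of_nonneg (inv_nonneg.2 expWeight_pos.le), inv_mul_le_iff₀ expWeight_pos]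
  calc _ ≤ ‖x₀‖ + ‖∫ s in t₀..max t t₀, v s 0‖ := norm_add_le _ _
    _ ≤ ‖x₀‖ * expWeight a t₀ (max t t₀) + 1 * expWeight a t₀ (max t t₀) := add_le_add hx₀ hint
    _ = _ := by ring

lemma norm_weightedPicard_sub_le (hv : Continuous (Function.uncurry v))
    (hvK : ∀ t, LipschitzWith K (v t)) (ha : Continuous a) (hKa : ∀ s, 2 * K ≤ a s)
    (hz : Continuous z) (hz' : Continuous z') {D : ℝ} (hD : ∀ s, ‖z s - z' s‖ ≤ D) (t : ℝ) :
    ‖weightedPicard v (expWeight a t₀) t₀ x₀ z t -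
      weightedPicard v (expWeight a t₀) t₀ x₀ z' t‖ ≤ 1 / 2 * D := by
  have hD0 : 0 ≤ D := (norm_nonneg _).trans (hD t₀)
  have hcont {y : ℝ → F} (hy : Continuous y) : Continuous fun s => v s (expWeight a t₀ s • y s) :=
    hv.comp (by fun_prop : Continuous fun s => (s, expWeight a t₀ s • y s))
  rw [weightedPicard, weightedPicard, ← smul_sub, add_sub_add_left_eq_sub,
    ← intervalIntegral.integral_sub ((hcont hz).intervalIntegrable _ _)
      ((hcont hz').intervalIntegrable _ _),
    norm_smul_of_nonneg (inv_nonneg.2 expWeight_pos.le), inv_mul_le_iff₀ expWeight_pos,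
    mul_comm (expWeight _ _ _)]
  refine norm_integral_le_mul_expWeight ha (by positivity) (le_max_right _ _) fun s _ => ?_
  have hω := (expWeight_pos (a := a) (t₀ := t₀) (t := s)).le
  calc _ ≤ K * ‖expWeight a t₀ s • z s - expWeight a t₀ s • z' s‖ := (hvK s).norm_sub_le _ _
    _ = K * (expWeight a t₀ s * ‖z s - z' s‖) := by rw [← smul_sub, norm_smul_of_nonneg hω]
    _ ≤ a s / 2 * (expWeight a t₀ s * D) := by
        have hKa' : K ≤ a s / 2 := by linarith [hKa s]
        exact mul_le_mul hKa' (mul_le_mul_of_nonneg_left (hD s) hω) (by positivity)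
          (K.coe_nonneg.trans hKa')
    _ = 1 / 2 * D * (expWeight a t₀ s * a s) := by ring

lemma isIntegralCurveOn_of_weightedPicard_eq [CompleteSpace F]
    (hv : Continuous (Function.uncurry v)) (ha : Continuous a) (hz : Continuous z)
    (hfix : weightedPicard v (expWeight a t₀) t₀ x₀ z = z) :
    z t₀ = x₀ ∧ IsIntegralCurveOn (fun t => expWeight a t₀ t • z t) v (Ici t₀) := by
  have hcont : Continuous fun s => v s (expWeight a t₀ s • z s) :=
    hv.comp (by fun_prop : Continuous fun s => (s, expWeight a t₀ s • z s))
  have hint : ∀ t ∈ Ici t₀, expWeight a t₀ t • z t =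
      x₀ + ∫ s in t₀..t, v s (expWeight a t₀ s • z s) := fun t ht => by
    conv_lhs => rw [← hfix, weightedPicard, max_eq_left ht, smul_inv_smul₀ expWeight_pos.ne']
  refine ⟨by simpa using hint t₀ self_mem_Ici, fun t ht => ?_⟩
  exact ((hcont.integral_hasStrictDerivAt t₀ t).hasDerivAt.const_add x₀).hasDerivWithinAt.congr
    hint (hint t ht)

lemma exists_isIntegralCurveOn_Ici_of_continuous [CompleteSpace F]
    (hv : Continuous (Function.uncurry v)) (hvK : ∀ t, LipschitzWith K (v t)) (t₀ : ℝ) (x₀ : F) :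
    ∃ x : ℝ → F, x t₀ = x₀ ∧ IsIntegralCurveOn x v (Ici t₀) := by
  let a : ℝ → ℝ := fun s => 2 * K + ‖v s 0‖
  have ha : Continuous a :=
    continuous_const.add (hv.comp (by fun_prop : Continuous fun s : ℝ => (s, (0 : F)))).norm
  have hva : ∀ s, ‖v s 0‖ ≤ a s := fun s => le_add_of_nonneg_left (by positivity)
  have hKa : ∀ s, 2 * K ≤ a s := fun s => le_add_of_nonneg_right (norm_nonneg _)
  let Φ : BoundedContinuousFunction ℝ F → BoundedContinuousFunction ℝ F := fun z =>
    .ofNormedAddCommGroup (weightedPicard v (expWeight a t₀) t₀ x₀ z)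
      (continuous_weightedPicard hv ha z.continuous) (1 / 2 * ‖z‖ + (‖x₀‖ + 1)) fun t =>
        (norm_le_norm_sub_add _ _).trans <| add_le_add
          (norm_weightedPicard_sub_le hv hvK ha hKa z.continuous continuous_zero
            (fun s => by simpa using z.norm_coe_le_norm s) t)
          (norm_weightedPicard_zero_le ha hva t)
  have hΦ : ContractingWith (1 / 2) Φ := by
    refine ⟨NNReal.half_lt_self one_ne_zero, LipschitzWith.of_dist_le_mul fun z z' => ?_⟩
    refine (BoundedContinuousFunction.dist_le (by positivity)).2 fun t => ?_
    rw [dist_eq_norm]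
    exact norm_weightedPicard_sub_le hv hvK ha hKa z.continuous z'.continuous
      (fun s => dist_eq_norm (z s) (z' s) ▸ BoundedContinuousFunction.dist_coe_le_dist s) t
  obtain ⟨hx₀, hx⟩ := isIntegralCurveOn_of_weightedPicard_eq hv ha hΦ.fixedPoint.continuous
    (congrArg (⇑) hΦ.fixedPoint_isFixedPt)
  exact ⟨_, by simpa using hx₀, hx⟩

lemma exists_isIntegralCurveOn_Ici [CompleteSpace F]
    (hv : ContinuousOn (Function.uncurry v) (Ici t₀ ×ˢ univ))
    (hvK : ∀ t, t₀ ≤ t → LipschitzWith K (v t)) (x₀ : F) :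
    ∃ x : ℝ → F, x t₀ = x₀ ∧ IsIntegralCurveOn x v (Ici t₀) := by
  have hmax : Continuous fun p : ℝ × F => (max p.1 t₀, p.2) := by fun_prop
  obtain ⟨x, hx₀, hx⟩ := exists_isIntegralCurveOn_Ici_of_continuous (v := fun t => v (max t t₀))
    (hv.comp_continuous hmax fun p => ⟨mem_Ici.2 (le_max_right _ _), mem_univ _⟩)
    (fun t => hvK _ (le_max_right _ _)) t₀ x₀
  refine ⟨x, hx₀, fun t ht => ?_⟩
  simpa only [max_eq_left (mem_Ici.1 ht)] using hx t ht

lemma forwardCompleteFrom_of_lipschitzWith {n : ℕ} {v : ℝ → Vec (Fin n) → Vec (Fin n)}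
    (hv : ContinuousOn (Function.uncurry v) (Ici t₀ ×ˢ univ))
    (hvK : ∀ t, t₀ ≤ t → LipschitzWith K (v t)) : ForwardCompleteFrom v t₀ := by
  refine fun x₀ => ⟨exists_isIntegralCurveOn_Ici hv hvK x₀, fun b _ y hy₀ hy => ?_⟩
  obtain ⟨x, hx₀, hx⟩ := exists_isIntegralCurveOn_Ici hv hvK x₀
  have hderiv {u : ℝ → Vec (Fin n)} {s : ℝ} (hu : IsIntegralCurveOn u v (Ico t₀ b))
      (hs : s ∈ Ico t₀ b) : HasDerivWithinAt u (v s (u s)) (Ici s) s :=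
    (hu s hs).mono_of_mem_nhdsWithin (Filter.mem_of_superset (Ico_mem_nhdsGE hs.2)
      (Ico_subset_Ico_left hs.1))
  have hxb : IsIntegralCurveOn x v (Ico t₀ b) := hx.mono Ico_subset_Ici_self
  refine ⟨x, hx, fun t ht => ?_⟩
  have hsub : Icc t₀ t ⊆ Ico t₀ b := Icc_subset_Ico_right ht.2
  exact ODE_solution_unique_of_mem_Icc_right (s := fun _ => univ)
    (fun s hs => (hvK s hs.1).lipschitzOnWith)
    (hxb.continuousOn.mono hsub) (fun s hs => hderiv hxb (hsub (Ico_subset_Icc_self hs)))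
    (fun _ _ => mem_univ _)
    (hy.continuousOn.mono hsub) (fun s hs => hderiv hy (hsub (Ico_subset_Icc_self hs)))
    (fun _ _ => mem_univ _) (hx₀.trans hy₀.symm) (right_mem_Icc.2 ht.1)

end GlobalExistence

section Exponential

variable {c l : ℝ}

lemma antitone_mul_exp_neg_mul (hc : 0 ≤ c) (hl : 0 ≤ l) :
    Antitone fun s => c * Real.exp (-l * s) := fun s t hst => by
  have := mul_le_mul_of_nonneg_left hst hl
  simp only [neg_mul]
  gcongr

lemma tendsto_mul_exp_neg_mul (hl : 0 < l) (c : ℝ) :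
    Tendsto (fun s => c * Real.exp (-l * s)) atTop (𝓝 0) := by
  simpa using (Real.tendsto_exp_atBot.comp
    (tendsto_id.const_mul_atTop_of_neg (neg_neg_of_pos hl))).const_mul c

lemma isClassKL_mul_exp_neg_mul (hc : 0 < c) (hl : 0 < l) :
    IsClassKL fun ρ t => c * Real.exp (-l * t) * ρ := by
  refine ⟨by unfold Function.uncurry; fun_prop, fun t _ => ⟨by simp, by fun_prop, ?_⟩,
    fun ρ hρ => ⟨((antitone_mul_exp_neg_mul hc.le hl.le).mul_const hρ).antitoneOn _, ?_⟩⟩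
  · exact (strictMono_mul_left_of_pos (by positivity)).strictMonoOn _
  · simpa using (tendsto_mul_exp_neg_mul hl c).mul_const ρ

lemma isClassKInfty_const_mul {g : ℝ} (hg : 0 < g) : IsClassKInfty fun s => g * s :=
  ⟨⟨by simp, by fun_prop, (strictMono_mul_left_of_pos hg).strictMonoOn _⟩,
    tendsto_id.const_mul_atTop hg⟩

end Exponential

section UniformLimit

open scoped NNReal

variable {F : Type*} [NormedAddCommGroup F] {v : ℝ → F → F} {K : ℝ≥0}

lemma tendstoUniformlyOn_apply_of_lipschitzWith (hvK : ∀ t, LipschitzWith K (v t)) {ι : Type*}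
    {p : Filter ι} {x : ι → ℝ → F} {y : ℝ → F} {s : Set ℝ} (hxy : TendstoUniformlyOn x y p s) :
    TendstoUniformlyOn (fun i t => v t (x i t)) (fun t => v t (y t)) p s := by
  rw [Metric.tendstoUniformlyOn_iff] at hxy ⊢
  intro ε hε
  filter_upwards [hxy (ε / (K + 1)) (by positivity)] with i hi t ht
  calc dist (v t (y t)) (v t (x i t)) ≤ K * dist (y t) (x i t) := (hvK t).dist_le_mul _ _
    _ ≤ (K + 1) * dist (y t) (x i t) := by gcongr; exact le_add_of_nonneg_right zero_le_one
    _ < ε := (lt_div_iff₀' (by positivity)).1 (hi t ht)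

lemma exists_mem_Ioi_neg_natCast (t : ℝ) : ∃ N : ℕ, t ∈ Ioi (-(N : ℝ)) :=
  (exists_nat_gt (-t)).imp fun _ hN => neg_lt.1 hN

lemma exists_tendstoUniformlyOn_Ioi [CompleteSpace F] {x : ℕ → ℝ → F} {ρ : ℝ → ℝ}
    (hρ : Antitone ρ) (hρ0 : Tendsto ρ atTop (𝓝 0))
    (hx : ∀ j k : ℕ, k ≤ j → ∀ t, -(k : ℝ) ≤ t → ‖x j t - x k t‖ ≤ ρ (t + k)) :
    ∃ y : ℝ → F, ∀ N : ℕ, TendstoUniformlyOn x y atTop (Ioi (-(N : ℝ))) := by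
  have hcauchy (N : ℕ) : UniformCauchySeqOn x atTop (Ioi (-(N : ℝ))) := by
    refine Metric.uniformCauchySeqOn_iff.2 fun ε hε => ?_
    obtain ⟨N₀, hN₀, hNN₀⟩ := (((hρ0.comp (tendsto_atTop_add_const_left _ (-(N : ℝ))
      tendsto_natCast_atTop_atTop)).eventually_lt_const hε).and (eventually_ge_atTop N)).exists
    refine ⟨N₀, fun j hj k hk t ht => ?_⟩
    wlog hkj : k ≤ j generalizing j k
    · rw [dist_comm]
      exact this k hk j hj (le_of_not_ge hkj)
    have hN₀k : (N₀ : ℝ) ≤ k := Nat.cast_le.2 hk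
    have hNk : (N : ℝ) ≤ k := Nat.cast_le.2 (hNN₀.trans hk)
    have ht : -(N : ℝ) < t := ht
    calc dist (x j t) (x k t) = ‖x j t - x k t‖ := dist_eq_norm _ _
      _ ≤ ρ (t + k) := hx j k hkj t (by linarith)
      _ ≤ ρ (-N + N₀) := hρ (by linarith)
      _ < ε := hN₀
  choose y hy using fun t => (exists_mem_Ioi_neg_natCast t).elim fun N ht =>
    cauchySeq_tendsto_of_complete ((hcauchy N).cauchySeq ht)
  exact ⟨y, fun N => (hcauchy N).tendstoUniformlyOn_of_tendsto fun t _ => hy t⟩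

variable [NormedSpace ℝ F]

lemma isIntegralCurveOn_of_tendstoUniformlyOn (hvK : ∀ t, LipschitzWith K (v t)) {ι : Type*}
    {p : Filter ι} [p.NeBot] {x : ι → ℝ → F} {y : ℝ → F} {s : Set ℝ} (hs : IsOpen s)
    (hx : ∀ᶠ i in p, IsIntegralCurveOn (x i) v s) (hxy : TendstoUniformlyOn x y p s) :
    IsIntegralCurveOn y v s := fun _ ht =>
  (hasDerivAt_of_tendstoUniformlyOn hs (tendstoUniformlyOn_apply_of_lipschitzWith hvK hxy)
    (hx.mono fun _ hi r hr => (hi r hr).hasDerivAt (hs.mem_nhds hr))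
    (fun _ hr => hxy.tendsto_at hr) ht).hasDerivWithinAt

end UniformLimit

section IncrementalISS

variable {F : Type*} [NormedAddCommGroup F] [NormedSpace ℝ F] {v : ℝ → F → F} {c l g : ℝ}

/-- Incremental exponential input-to-state stability of `ẋ = v(t, x)` with overshoot `c`, rate `l`
and linear gain `g`: a trajectory `x` with additive input `w` and a trajectory `y` without input
approach each other exponentially, up to an error proportional to the size `W` of the input. -/
structure IsIncrementallyISS (v : ℝ → F → F) (c l g : ℝ) : Prop where
  overshoot_pos : 0 < c
  rate_pos : 0 < l
  gain_pos : 0 < g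
  norm_sub_le : ∀ ⦃a b : ℝ⦄, a ≤ b → ∀ ⦃x y w : ℝ → F⦄ ⦃W : ℝ⦄,
    IsIntegralCurveOn x (fun t x => v t x + w t) (Icc a b) → IsIntegralCurveOn y v (Icc a b) →
    (∀ t ∈ Icc a b, ‖w t‖ ≤ W) →
    ‖x b - y b‖ ≤ c * Real.exp (-l * (b - a)) * ‖x a - y a‖ + g * W

namespace IsIncrementallyISS

lemma norm_sub_le_mul_exp (hv : IsIncrementallyISS v c l g) {a b : ℝ} (hab : a ≤ b)
    {x y : ℝ → F} (hx : IsIntegralCurveOn x v (Icc a b)) (hy : IsIntegralCurveOn y v (Icc a b)) :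
    ‖x b - y b‖ ≤ c * Real.exp (-l * (b - a)) * ‖x a - y a‖ := by
  simpa using hv.norm_sub_le hab (w := 0) (W := 0) (by simpa using hx) hy (by simp)

-- The zero function is the trajectory of the system with input `-v(t, 0)`.
lemma norm_le_of_eq_zero (hv : IsIncrementallyISS v c l g) {M : ℝ} (hM : ∀ t, ‖v t 0‖ ≤ M)
    {a b : ℝ} (hab : a ≤ b) {x : ℝ → F} (hx : IsIntegralCurveOn x v (Icc a b)) (hxa : x a = 0) :
    ‖x b‖ ≤ g * M := by
  simpa [hxa] using hv.norm_sub_le hab (x := fun _ => 0) (w := fun t => -v t 0)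
    (fun t _ => by simpa using hasDerivWithinAt_const t (Icc a b) (0 : F)) hx
    (fun t _ => by simpa using hM t)

lemma norm_sub_le_of_pullback (hv : IsIncrementallyISS v c l g) {M : ℝ}
    (hM : ∀ t, ‖v t 0‖ ≤ M) {x y : ℝ → F} {a b t : ℝ} (hba : b ≤ a) (hat : a ≤ t)
    (hx : IsIntegralCurveOn x v (Ici b)) (hxb : x b = 0)
    (hy : IsIntegralCurveOn y v (Ici a)) (hya : y a = 0) :
    ‖x t - y t‖ ≤ c * Real.exp (-l * (t - a)) * (g * M) := by
  have hxa : ‖x a‖ ≤ g * M := hv.norm_le_of_eq_zero hM hba (hx.mono Icc_subset_Ici_self) hxb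
  have h := hv.norm_sub_le_mul_exp hat
    (hx.mono (Icc_subset_Ici_self.trans (Ici_subset_Ici.2 hba))) (hy.mono Icc_subset_Ici_self)
  rw [hya, sub_zero] at h
  have := hv.overshoot_pos
  exact h.trans (by gcongr)

lemma exists_bounded_isIntegralCurve [CompleteSpace F] (hv : IsIncrementallyISS v c l g)
    (hcont : Continuous (Function.uncurry v)) {K : NNReal} (hvK : ∀ t, LipschitzWith K (v t))
    {M : ℝ} (hM : ∀ t, ‖v t 0‖ ≤ M) :
    ∃ x : ℝ → F, IsIntegralCurve x v ∧ ∃ C, ∀ t, ‖x t‖ ≤ C := by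
  have hM0 : 0 ≤ M := (norm_nonneg _).trans (hM 0)
  have hgM : 0 ≤ g * M := mul_nonneg hv.gain_pos.le hM0
  choose x hx₀ hx using fun k : ℕ =>
    exists_isIntegralCurveOn_Ici_of_continuous hcont hvK (-(k : ℝ)) 0
  obtain ⟨y, hxy⟩ := exists_tendstoUniformlyOn_Ioi
    ((antitone_mul_exp_neg_mul hv.overshoot_pos.le hv.rate_pos.le).mul_const hgM)
    (by simpa using (tendsto_mul_exp_neg_mul hv.rate_pos c).mul_const (g * M))
    (x := x) fun j k hkj t ht => by
      simpa using hv.norm_sub_le_of_pullback hM (by simpa using hkj) ht (hx j) (hx₀ j) (hx k)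
        (hx₀ k)
  have hsub {k N : ℕ} (h : N ≤ k) : Ioi (-(N : ℝ)) ⊆ Ici (-(k : ℝ)) :=
    Ioi_subset_Ici (neg_le_neg (Nat.cast_le.2 h))
  refine ⟨y, fun t => ?_, g * M, fun t => ?_⟩ <;> obtain ⟨N, ht⟩ := exists_mem_Ioi_neg_natCast t
  · exact (isIntegralCurveOn_of_tendstoUniformlyOn hvK isOpen_Ioi
      ((eventually_ge_atTop N).mono fun k hk => (hx k).mono (hsub hk)) (hxy N) t ht).hasDerivAt
      (Ioi_mem_nhds ht)
  · refine le_of_tendsto ((hxy N).tendsto_at ht).norm ((eventually_ge_atTop N).mono fun k hk => ?_)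
    exact hv.norm_le_of_eq_zero hM (hsub hk ht) ((hx k).mono Icc_subset_Ici_self) (hx₀ k)

lemma eq_of_bounded (hv : IsIncrementallyISS v c l g) {x y : ℝ → F} (hx : IsIntegralCurve x v)
    (hy : IsIntegralCurve y v) {C D : ℝ} (hxC : ∀ t, ‖x t‖ ≤ C) (hyD : ∀ t, ‖y t‖ ≤ D) :
    x = y := by
  funext t
  have hle : ∀ᶠ s in atTop, ‖x t - y t‖ ≤ c * Real.exp (-l * s) * (C + D) := by
    filter_upwards [eventually_ge_atTop 0] with s hs
    have h := hv.norm_sub_le_mul_exp (sub_le_self t hs) (hx.isIntegralCurveOn _)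
      (hy.isIntegralCurveOn _)
    rw [sub_sub_cancel] at h
    have := hv.overshoot_pos
    exact h.trans (by gcongr; exact norm_sub_le_of_le (hxC _) (hyD _))
  have hlim : Tendsto (fun s => c * Real.exp (-l * s) * (C + D)) atTop (𝓝 0) := by
    simpa using (tendsto_mul_exp_neg_mul hv.rate_pos c).mul_const (C + D)
  exact sub_eq_zero.1 (norm_le_zero_iff.1 (ge_of_tendsto hlim hle))

lemma norm_sub_le_add_sSup (hv : IsIncrementallyISS v c l g) {x y w : ℝ → F} {t : ℝ}
    (ht : 0 ≤ t) (hw : ContinuousOn w (Ici 0))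
    (hx : IsIntegralCurveOn x (fun t x => v t x + w t) (Ici 0)) (hy : IsIntegralCurve y v) :
    ‖x t - y t‖ ≤ c * Real.exp (-l * t) * ‖x 0 - y 0‖ +
      g * sSup ((fun σ => ‖w σ‖) '' Icc 0 t) := by
  have hbdd : BddAbove ((fun σ => ‖w σ‖) '' Icc 0 t) :=
    isCompact_Icc.bddAbove_image (hw.norm.mono Icc_subset_Ici_self)
  simpa using hv.norm_sub_le ht (hx.mono Icc_subset_Ici_self) (hy.isIntegralCurveOn _)
    fun σ hσ => le_csSup hbdd (mem_image_of_mem _ hσ)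

end IsIncrementallyISS

end IncrementalISS

section Convergence

open scoped NNReal

variable {n : ℕ} {v : ℝ → Vec (Fin n) → Vec (Fin n)} {x y : ℝ → Vec (Fin n)} {c l g : ℝ}

lemma IsBoundedSolution.eq (hx : IsBoundedSolution v x) (hy : IsBoundedSolution v y)
    (hv : IsIncrementallyISS v c l g) : x = y :=
  let ⟨_, hC⟩ := hx.2
  let ⟨_, hD⟩ := hy.2
  hv.eq_of_bounded hx.1 hy.1 hC hD

lemma IsBoundedSolution.periodic (hx : IsBoundedSolution v x) (hv : IsIncrementallyISS v c l g)
    {θ : ℝ} (hθ : Function.Periodic v θ) : Function.Periodic x θ := by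
  have hshift : IsBoundedSolution v (x ∘ (· + θ)) := by
    refine ⟨?_, hx.2.imp fun C hC t => hC _⟩
    have h := hx.1.comp_add θ
    rwa [show v ∘ (· + θ) = v from funext hθ] at h
  exact congrFun (hshift.eq hx hv)

lemma IsIncrementallyISS.isConvergent (hv : IsIncrementallyISS v c l g)
    (hcont : Continuous (Function.uncurry v)) {K : ℝ≥0} (hvK : ∀ t, LipschitzWith K (v t))
    {M : ℝ} (hM : ∀ t, ‖v t 0‖ ≤ M) : IsConvergent v := by
  obtain ⟨xs, hxs⟩ : ∃ xs, IsBoundedSolution v xs := hv.exists_bounded_isIntegralCurve hcont hvK hM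
  refine ⟨fun t₀ => forwardCompleteFrom_of_lipschitzWith hcont.continuousOn fun t _ => hvK t, xs,
    ⟨hxs, fun y hy => hy.eq hxs hv⟩, c, hv.overshoot_pos, l, hv.rate_pos, fun t₀ x hx t ht => ?_⟩
  exact hv.norm_sub_le_mul_exp ht (hx.mono Icc_subset_Ici_self) (hxs.1.isIntegralCurveOn _)

end Convergence

section Lyapunov

open scoped RealInnerProductSpace

lemma le_mul_exp_add_of_deriv_le {V V' : ℝ → ℝ} {a b k r : ℝ} (hk : 0 < k) (hr : 0 ≤ r)
    (hab : a ≤ b) (hV : ∀ t ∈ Icc a b, HasDerivWithinAt V (V' t) (Icc a b) t)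
    (hV' : ∀ t ∈ Icc a b, V' t ≤ -k * V t + r) :
    V b ≤ V a * Real.exp (-k * (b - a)) + r / k := by
  have h : V b ≤ gronwallBound (V a) (-k) r (b - a) :=
    le_gronwallBound_of_liminf_deriv_right_le (fun t ht => (hV t ht).continuousWithinAt)
      (fun t ht _ => ((hV t (Ico_subset_Icc_self ht)).mono_of_mem_nhdsWithin
        (Icc_mem_nhdsGE_of_mem ht)).liminf_right_slope_le) le_rfl
      (fun t ht => hV' t (Ico_subset_Icc_self ht)) b (right_mem_Icc.2 hab)
  rw [gronwallBound_of_K_ne_0 (neg_ne_zero.2 hk.ne'), div_neg] at h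
  have : 0 ≤ r / k * Real.exp (-k * (b - a)) := by positivity
  linarith

variable {F : Type*} [NormedAddCommGroup F] [InnerProductSpace ℝ F]

lemma two_mul_inner_le (x y : F) {β : ℝ} (hβ : 0 < β) :
    2 * ⟪x, y⟫ ≤ β * ‖x‖ ^ 2 + ‖y‖ ^ 2 / β :=
  calc 2 * ⟪x, y⟫ ≤ 2 * (‖x‖ * ‖y‖) := by gcongr; exact real_inner_le_norm x y
    _ = β * ‖x‖ ^ 2 + ‖y‖ ^ 2 / β - (β * ‖x‖ - ‖y‖) ^ 2 / β := by field_simp; ring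
    _ ≤ β * ‖x‖ ^ 2 + ‖y‖ ^ 2 / β := sub_le_self _ (by positivity)

variable {H : F →L[ℝ] F} {m β : ℝ} {e e' w : ℝ → F}

lemma mul_inner_self_le_norm_sq (hm : 0 ≤ m) (hH : ∀ x, m * ‖x‖ ^ 2 ≤ ⟪H x, x⟫) (x : F) :
    m * ⟪H x, x⟫ ≤ ‖H x‖ ^ 2 := by
  have hx : m * ‖x‖ ≤ ‖H x‖ := by
    rcases (norm_nonneg x).eq_or_lt with hx | hx
    · simp [← hx]
    · refine le_of_mul_le_mul_right ?_ hx
      linarith [hH x, real_inner_le_norm (H x) x]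
  calc m * ⟪H x, x⟫ ≤ m * (‖H x‖ * ‖x‖) := by gcongr; exact real_inner_le_norm _ _
    _ = (m * ‖x‖) * ‖H x‖ := by ring
    _ ≤ ‖H x‖ * ‖H x‖ := by gcongr
    _ = ‖H x‖ ^ 2 := (sq _).symm

lemma hasDerivWithinAt_inner_self (hsymm : H.toLinearMap.IsSymmetric) {s : Set ℝ} {t : ℝ} {e₁ : F}
    (he : HasDerivWithinAt e e₁ s t) :
    HasDerivWithinAt (fun t => ⟪H (e t), e t⟫) (2 * ⟪H (e t), e₁⟫) s t := by
  have hswap : ⟪H e₁, e t⟫ = ⟪H (e t), e₁⟫ := (hsymm e₁ (e t)).trans (real_inner_comm _ _)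
  refine ((H.hasFDerivAt.comp_hasDerivWithinAt t he).inner ℝ he).congr_deriv ?_
  rw [hswap, two_mul]
  rfl

lemma mul_norm_sq_le_of_dissipation (hsymm : H.toLinearMap.IsSymmetric) (hm : 0 < m)
    (hH : ∀ x, m * ‖x‖ ^ 2 ≤ ⟪H x, x⟫) (hβ : 0 < β) {a b W : ℝ} (hab : a ≤ b)
    (he : ∀ t ∈ Icc a b, HasDerivWithinAt e (e' t) (Icc a b) t)
    (hdis : ∀ t ∈ Icc a b, ⟪H (e t), e' t⟫ ≤ -β * ‖H (e t)‖ ^ 2 + ⟪H (e t), w t⟫)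
    (hw : ∀ t ∈ Icc a b, ‖w t‖ ≤ W) :
    m * ‖e b‖ ^ 2 ≤ ⟪H (e a), e a⟫ * Real.exp (-(β * m) * (b - a)) + W ^ 2 / β / (β * m) := by
  refine (hH (e b)).trans <| le_mul_exp_add_of_deriv_le (mul_pos hβ hm) (by positivity) hab
    (fun t ht => hasDerivWithinAt_inner_self hsymm (he t ht)) fun t ht => ?_
  have hW : ‖w t‖ ^ 2 / β ≤ W ^ 2 / β := by gcongr; exact hw t ht
  calc 2 * ⟪H (e t), e' t⟫ ≤ 2 * (-β * ‖H (e t)‖ ^ 2 + ⟪H (e t), w t⟫) := by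
        gcongr; exact hdis t ht
    _ ≤ -β * ‖H (e t)‖ ^ 2 + W ^ 2 / β := by linarith [two_mul_inner_le (H (e t)) (w t) hβ]
    _ ≤ -(β * m) * ⟪H (e t), e t⟫ + W ^ 2 / β := by
        linarith [mul_le_mul_of_nonneg_left (mul_inner_self_le_norm_sq hm.le hH (e t)) hβ.le]

lemma inner_self_le_opNorm_mul (x : F) : ⟪H x, x⟫ ≤ ‖H‖ * ‖x‖ ^ 2 :=
  calc ⟪H x, x⟫ ≤ ‖H x‖ * ‖x‖ := real_inner_le_norm _ _
    _ ≤ ‖H‖ * ‖x‖ * ‖x‖ := by gcongr; exact H.le_opNorm x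
    _ = ‖H‖ * ‖x‖ ^ 2 := by ring

lemma isIncrementallyISS_of_dissipation {v : ℝ → F → F} (hsymm : H.toLinearMap.IsSymmetric)
    (hm : 0 < m) (hH : ∀ x, m * ‖x‖ ^ 2 ≤ ⟪H x, x⟫) (hβ : 0 < β)
    (hv : ∀ t x y, ⟪H (x - y), v t x - v t y⟫ ≤ -β * ‖H (x - y)‖ ^ 2) :
    IsIncrementallyISS v √((‖H‖ + 1) / m) (β * m / 2) (1 / (β * m)) := by
  refine ⟨by positivity, by positivity, by positivity, fun a b hab x y w W hx hy hw => ?_⟩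
  have hW : 0 ≤ W := (norm_nonneg _).trans (hw a (left_mem_Icc.2 hab))
  set p := √((‖H‖ + 1) / m) * Real.exp (-(β * m / 2) * (b - a)) * ‖x a - y a‖
  set q := 1 / (β * m) * W
  have hV := mul_norm_sq_le_of_dissipation hsymm hm hH hβ hab (fun t ht => (hx t ht).sub (hy t ht))
    (fun t _ => by
      simp only [add_sub_right_comm (v t (x t)), inner_add_right]
      gcongr
      exact hv t (x t) (y t)) hw
  have hVa : ⟪H (x a - y a), x a - y a⟫ ≤ (‖H‖ + 1) * ‖x a - y a‖ ^ 2 :=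
    (inner_self_le_opNorm_mul _).trans (by gcongr; exact le_add_of_nonneg_right zero_le_one)
  have hp : m * p ^ 2 = (‖H‖ + 1) * ‖x a - y a‖ ^ 2 * Real.exp (-(β * m) * (b - a)) := by
    rw [mul_pow, mul_pow, Real.sq_sqrt (by positivity), ← Real.exp_nat_mul]
    field_simp
    ring_nf
  have hq : m * q ^ 2 = W ^ 2 / β / (β * m) := by simp only [q]; field_simp
  have hsq : m * ‖x b - y b‖ ^ 2 ≤ m * (p ^ 2 + q ^ 2) := by
    rw [mul_add, hp, hq]
    exact hV.trans (by gcongr; exact hVa)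
  refine abs_le_of_sq_le_sq' ?_ (by positivity) |>.2
  have hpq : 0 ≤ p * q := by positivity
  linarith [le_of_mul_le_mul_left hsq hm, add_sq p q]

end Lyapunov

section Coercive

open scoped RealInnerProductSpace

lemma exists_pos_mul_norm_sq_le_inner {F : Type*} [NormedAddCommGroup F] [InnerProductSpace ℝ F]
    [FiniteDimensional ℝ F] {H : F →L[ℝ] F} (hH : ∀ x, x ≠ 0 → 0 < ⟪H x, x⟫) :
    ∃ m : ℝ, 0 < m ∧ ∀ x, m * ‖x‖ ^ 2 ≤ ⟪H x, x⟫ := by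
  rcases subsingleton_or_nontrivial F with hF | hF
  · exact ⟨1, one_pos, fun x => by simp [Subsingleton.elim x 0]⟩
  obtain ⟨z, hz, hmin⟩ := (isCompact_sphere (0 : F) 1).exists_isMinOn
    (NormedSpace.sphere_nonempty.2 zero_le_one)
    (by fun_prop : Continuous fun x => ⟪H x, x⟫).continuousOn
  refine ⟨⟪H z, z⟫, hH z (ne_zero_of_mem_unit_sphere ⟨z, hz⟩), fun x => ?_⟩
  rcases eq_or_ne x 0 with rfl | hx
  · simp
  have hunit : ‖x‖⁻¹ • x ∈ Metric.sphere (0 : F) 1 := by simp [norm_smul, hx]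
  have hxz : ⟪H z, z⟫ ≤ ⟪H (‖x‖⁻¹ • x), ‖x‖⁻¹ • x⟫ := hmin hunit
  rw [map_smul, real_inner_smul_left, real_inner_smul_right] at hxz
  calc ⟪H z, z⟫ * ‖x‖ ^ 2 ≤ ‖x‖⁻¹ * (‖x‖⁻¹ * ⟪H x, x⟫) * ‖x‖ ^ 2 := by gcongr
    _ = ⟪H x, x⟫ := by field_simp

end Coercive

section MatrixVector

open scoped RealInnerProductSpace Matrix.Norms.L2Operator

variable {ι κ l : Type} [Fintype ι] [Fintype κ] [Fintype l]

lemma inner_eq_dotProduct (x y : Vec ι) : ⟪x, y⟫ = x.ofLp ⬝ᵥ y.ofLp := by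
  rw [EuclideanSpace.inner_eq_star_dotProduct, star_trivial, dotProduct_comm]

lemma mulV_add (M : Matrix ι κ ℝ) (x y : Vec κ) : mulV M (x + y) = mulV M x + mulV M y := by
  simp only [mulV, WithLp.ofLp_add, Matrix.mulVec_add, WithLp.toLp_add]

lemma mulV_sub (M : Matrix ι κ ℝ) (x y : Vec κ) : mulV M (x - y) = mulV M x - mulV M y := by
  simp only [mulV, WithLp.ofLp_sub, Matrix.mulVec_sub, WithLp.toLp_sub]

lemma mulV_mul (M : Matrix ι κ ℝ) (N : Matrix κ l ℝ) (x : Vec l) :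
    mulV (M * N) x = mulV M (mulV N x) := by
  simp only [mulV, Matrix.mulVec_mulVec]

lemma sub_mulV (M N : Matrix ι κ ℝ) (x : Vec κ) : mulV (M - N) x = mulV M x - mulV N x := by
  simp only [mulV, Matrix.sub_mulVec, WithLp.toLp_sub]

lemma inner_mulV_right (M : Matrix ι κ ℝ) (x : Vec ι) (y : Vec κ) :
    ⟪x, mulV M y⟫ = ⟪mulV Mᵀ x, y⟫ := by
  rw [inner_eq_dotProduct, inner_eq_dotProduct, dotProduct_comm (mulV Mᵀ x).ofLp]
  exact (Matrix.dotProduct_transpose_mulVec M y.ofLp x.ofLp).symm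

lemma lipschitzWith_mulV [DecidableEq κ] (M : Matrix ι κ ℝ) : LipschitzWith ‖M‖₊ (mulV M) :=
  LipschitzWith.of_dist_le_mul fun x y => by
    rw [dist_eq_norm, dist_eq_norm, ← mulV_sub]
    exact Matrix.l2_opNorm_mulVec M _

lemma norm_sq_mulV_transpose (M : Matrix ι κ ℝ) (x : Vec ι) :
    ‖mulV Mᵀ x‖ ^ 2 = x.ofLp ⬝ᵥ (M * Mᵀ) *ᵥ x.ofLp := by
  rw [← real_inner_self_eq_norm_sq, ← inner_mulV_right, ← mulV_mul, inner_eq_dotProduct]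
  rfl

lemma posSemidef_mul_transpose_sub_iff {M : Matrix ι κ ℝ} {N : Matrix ι l ℝ} :
    (M * Mᵀ - N * Nᵀ).PosSemidef ↔ ∀ x, ‖mulV Nᵀ x‖ ≤ ‖mulV Mᵀ x‖ := by
  have hherm : (M * Mᵀ - N * Nᵀ).IsHermitian := by
    simp [Matrix.IsHermitian, Matrix.conjTranspose_eq_transpose_of_trivial]
  rw [Matrix.posSemidef_iff_dotProduct_mulVec, and_iff_right hherm]
  refine (WithLp.ofLp_surjective 2).forall.trans (forall_congr' fun x => ?_)
  rw [← sq_le_sq₀ (norm_nonneg _) (norm_nonneg _), norm_sq_mulV_transpose,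
    norm_sq_mulV_transpose, star_trivial, Matrix.sub_mulVec,
    dotProduct_sub, sub_nonneg]

lemma posSemidef_smul_one_mul_transpose_sub [DecidableEq ι] {D : Matrix ι κ ℝ} {δ : ℝ}
    (hD : ∀ k, ‖(WithLp.toLp 2 (D.col k) : Vec ι)‖ ≤ δ) :
    ((δ * √(Fintype.card κ)) • (1 : Matrix ι ι ℝ) *
      ((δ * √(Fintype.card κ)) • (1 : Matrix ι ι ℝ))ᵀ - D * Dᵀ).PosSemidef := by
  refine posSemidef_mul_transpose_sub_iff.2 fun x => ?_
  have hk (k : κ) : (mulV Dᵀ x) k ^ 2 ≤ (δ * ‖x‖) ^ 2 := by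
    have hinner : (mulV Dᵀ x) k = ⟪(WithLp.toLp 2 (D.col k) : Vec ι), x⟫ :=
      (inner_eq_dotProduct (WithLp.toLp 2 (D.col k)) x).symm
    rw [hinner]
    refine sq_le_sq' (neg_le_of_abs_le ?_) (le_of_abs_le ?_) <;>
      exact (abs_real_inner_le_norm _ x).trans (by gcongr; exact hD k)
  have hsmul : mulV ((δ * √(Fintype.card κ)) • (1 : Matrix ι ι ℝ))ᵀ x =
      (δ * √(Fintype.card κ)) • x := by
    simp [mulV, Matrix.smul_mulVec]
  rw [hsmul, ← sq_le_sq₀ (norm_nonneg _) (norm_nonneg _), norm_smul, EuclideanSpace.real_norm_sq_eq]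
  calc ∑ k, (mulV Dᵀ x) k ^ 2 ≤ ∑ _k : κ, (δ * ‖x‖) ^ 2 := Finset.sum_le_sum fun k _ => hk k
    _ = (‖δ * √(Fintype.card κ)‖ * ‖x‖) ^ 2 := by
      rw [Finset.sum_const, nsmul_eq_mul, Finset.card_univ, mul_pow, mul_pow, Real.norm_eq_abs,
        sq_abs, mul_pow, Real.sq_sqrt (Nat.cast_nonneg _)]
      ring

end MatrixVector

section LinearMatrixInequality

open scoped RealInnerProductSpace

variable {n q r τ T : ℕ} {X₁ : Matrix (Fin n) (Fin T) ℝ} {E : Matrix (Fin n) (Fin q) ℝ}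
  {Δ : Matrix (Fin q) (Fin q) ℝ} {R : Matrix (Fin n) (Fin τ) ℝ} {P : Matrix (Fin n) (Fin n) ℝ}
  {Y₁ : Matrix (Fin T) (Fin n) ℝ} {G₂ : Matrix (Fin T) (Fin r) ℝ} {α μ : ℝ}

lemma dotProduct_fromBlocks_transpose_mulVec {ι κ : Type*} [Fintype ι] [Fintype κ]
    (M : Matrix ι ι ℝ) (N : Matrix κ ι ℝ) (L : Matrix κ κ ℝ) (x : ι → ℝ) (y : κ → ℝ) :
    Sum.elim x y ⬝ᵥ Matrix.fromBlocks M Nᵀ N L *ᵥ Sum.elim x y =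
      x ⬝ᵥ M *ᵥ x + 2 * (y ⬝ᵥ N *ᵥ x) + y ⬝ᵥ L *ᵥ y := by
  rw [Matrix.fromBlocks_mulVec, Sum.elim_comp_inl, Sum.elim_comp_inr, sumElim_dotProduct_sumElim,
    dotProduct_add, dotProduct_add, Matrix.dotProduct_transpose_mulVec]
  ring

lemma quadraticForm_nonpos_of_lmiMatrix (h : (-lmiMatrix X₁ E Δ R P Y₁ G₂ α μ).PosSemidef)
    (u : Vec (Fin n)) (a : Vec (Fin r)) (b : Vec (Fin τ)) (c : Vec (Fin T)) :
    2 * ⟪u, mulV X₁ (mulV Y₁ u + mulV G₂ a)⟫ + α * ‖u‖ ^ 2 + μ * ‖mulV Δᵀ (mulV Eᵀ u)‖ ^ 2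
      - ‖a‖ ^ 2 + 2 * ⟪b, mulV Rᵀ (mulV P u)⟫ - ‖b‖ ^ 2 + 2 * ⟪c, mulV Y₁ u + mulV G₂ a⟫
      - μ * ‖c‖ ^ 2 ≤ 0 := by
  have hquad := h.dotProduct_mulVec_nonneg
    (Sum.elim (Sum.elim u.ofLp a.ofLp) (Sum.elim b.ofLp c.ofLp))
  have hblocks : (Matrix.fromBlocks (Rᵀ * P)ᵀ Y₁ᵀ 0 G₂ᵀ :
      Matrix (Fin n ⊕ Fin r) (Fin τ ⊕ Fin T) ℝ) = (Matrix.fromBlocks (Rᵀ * P) 0 Y₁ G₂)ᵀ := by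
    rw [Matrix.fromBlocks_transpose, Matrix.transpose_zero]
  have hcross : a.ofLp ⬝ᵥ (G₂ᵀ * X₁ᵀ) *ᵥ u.ofLp = u.ofLp ⬝ᵥ (X₁ * G₂) *ᵥ a.ofLp := by
    rw [← Matrix.transpose_mul, Matrix.dotProduct_transpose_mulVec]
  have hdist : ‖mulV Δᵀ (mulV Eᵀ u)‖ ^ 2 = u.ofLp ⬝ᵥ (E * Δ * Δᵀ * Eᵀ) *ᵥ u.ofLp := by
    rw [← mulV_mul, ← Matrix.transpose_mul, norm_sq_mulV_transpose]
    simp only [Matrix.transpose_mul, Matrix.mul_assoc]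
  rw [lmiMatrix, hblocks, Matrix.neg_mulVec, dotProduct_neg, star_trivial,
    dotProduct_fromBlocks_transpose_mulVec, dotProduct_fromBlocks_transpose_mulVec, hcross] at hquad
  simp only [Matrix.fromBlocks_mulVec, Sum.elim_comp_inl, Sum.elim_comp_inr,
    sumElim_dotProduct_sumElim, Matrix.add_mulVec, Matrix.smul_mulVec, Matrix.neg_mulVec,
    Matrix.one_mulVec, Matrix.zero_mulVec, dotProduct_add, dotProduct_smul,
    dotProduct_neg, smul_eq_mul, add_zero, zero_add, Matrix.dotProduct_transpose_mulVec,
    ← hdist] at hquad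
  simp only [← real_inner_self_eq_norm_sq, inner_eq_dotProduct, mulV, Matrix.mulVec_add,
    WithLp.ofLp_add, dotProduct_add, Matrix.mulVec_mulVec] at hquad ⊢
  linarith

lemma two_mul_inner_le_of_lmiMatrix (h : (-lmiMatrix X₁ E Δ R P Y₁ G₂ α μ).PosSemidef) (hμ : 0 ≤ μ)
    {D : Matrix (Fin q) (Fin T) ℝ} (hD : (Δ * Δᵀ - D * Dᵀ).PosSemidef)
    {u : Vec (Fin n)} {a : Vec (Fin r)} (ha : ‖a‖ ≤ ‖mulV Rᵀ (mulV P u)‖) :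
    2 * ⟪u, mulV (X₁ - E * D) (mulV Y₁ u + mulV G₂ a)⟫ ≤ -α * ‖u‖ ^ 2 := by
  set b := mulV Rᵀ (mulV P u)
  set z := mulV Y₁ u + mulV G₂ a
  set y := mulV Dᵀ (mulV Eᵀ u)
  have hquad := quadraticForm_nonpos_of_lmiMatrix h u a b (-y)
  have hyz : ⟪u, mulV E (mulV D z)⟫ = ⟪y, z⟫ := by rw [inner_mulV_right, inner_mulV_right]
  have hy : μ * ‖y‖ ^ 2 ≤ μ * ‖mulV Δᵀ (mulV Eᵀ u)‖ ^ 2 := by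
    gcongr
    exact posSemidef_mul_transpose_sub_iff.1 hD _
  have ha' : ‖a‖ ^ 2 ≤ ‖b‖ ^ 2 := by gcongr
  rw [real_inner_self_eq_norm_sq, inner_neg_left, norm_neg] at hquad
  rw [sub_mulV, mulV_mul, inner_sub_right, hyz]
  linarith

end LinearMatrixInequality

section DataRepresentation

variable {n m r q T : ℕ} {A : Matrix (Fin n) (Fin n ⊕ Fin r) ℝ} {B : Matrix (Fin n) (Fin m) ℝ}
  {E : Matrix (Fin n) (Fin q) ℝ}

/-- The matrix `D₀ = [d_0 … d_{T-1}]` of the unknown disturbance samples of an experiment. -/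
def Experiment.D0 {f : Vec (Fin n) → Vec (Fin n)} (e : Experiment f B E T) :
    Matrix (Fin q) (Fin T) ℝ :=
  Matrix.of fun i k => e.disturbance (e.time k) i

lemma Experiment.X1_eq {f : Vec (Fin n) → Vec (Fin n)} (e : Experiment f B E T)
    {Q : Vec (Fin n) → Vec (Fin r)} (hf : ∀ x, f x = mulV A (dict Q x)) :
    e.X1 = A * e.Z0 Q + B * e.U0 + E * e.D0 := by
  ext i k
  simp only [Experiment.X1, Matrix.of_apply, e.plant k, hf]
  rfl

lemma Experiment.posSemidef_sub_D0 {f : Vec (Fin n) → Vec (Fin n)} (e : Experiment f B E T) {δ : ℝ}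
    (he : ∀ i, ‖e.disturbance (e.time i)‖ ≤ δ) :
    ((δ * √(T : ℝ)) • (1 : Matrix (Fin q) (Fin q) ℝ) *
      ((δ * √(T : ℝ)) • (1 : Matrix (Fin q) (Fin q) ℝ))ᵀ - e.D0 * e.D0ᵀ).PosSemidef := by
  simpa only [Fintype.card_fin] using posSemidef_smul_one_mul_transpose_sub (D := e.D0) he

lemma add_mul_gain_eq {X₁ : Matrix (Fin n) (Fin T) ℝ} {Z₀ : Matrix (Fin n ⊕ Fin r) (Fin T) ℝ}
    {U₀ : Matrix (Fin m) (Fin T) ℝ} {D₀ : Matrix (Fin q) (Fin T) ℝ}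
    (hdata : X₁ = A * Z₀ + B * U₀ + E * D₀) {P : Matrix (Fin n) (Fin n) ℝ} (hP : IsUnit P)
    {Y₁ : Matrix (Fin T) (Fin n) ℝ} (hY₁ : Z₀ * Y₁ = Matrix.fromRows P 0)
    {G₂ : Matrix (Fin T) (Fin r) ℝ} (hG₂ : Z₀ * G₂ = Matrix.fromRows 0 1) :
    A + B * gain U₀ P Y₁ G₂ = (X₁ - E * D₀) * Matrix.fromCols (Y₁ * P⁻¹) G₂ := by
  have hZ₀ : Z₀ * Matrix.fromCols (Y₁ * P⁻¹) G₂ = 1 := by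
    rw [Matrix.mul_fromCols, ← Matrix.mul_assoc, hY₁, hG₂, Matrix.fromRows_mul,
      Matrix.mul_nonsing_inv _ ((Matrix.isUnit_iff_isUnit_det _).1 hP), Matrix.zero_mul,
      Matrix.fromCols_fromRows_eq_fromBlocks, Matrix.fromBlocks_one]
  rw [hdata, add_sub_cancel_right, Matrix.add_mul, Matrix.mul_assoc A, hZ₀, Matrix.mul_one,
    gain, Matrix.mul_assoc]

end DataRepresentation

section Dictionary

open scoped RealInnerProductSpace Matrix.Norms.L2Operator NNReal

variable {n r τ : ℕ} {Q : Vec (Fin n) → Vec (Fin r)} {R : Matrix (Fin n) (Fin τ) ℝ}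

lemma mulV_fromCols_dict {ι : Type} [Fintype ι] (M : Matrix ι (Fin n) ℝ) (N : Matrix ι (Fin r) ℝ)
    (Q : Vec (Fin n) → Vec (Fin r)) (x : Vec (Fin n)) :
    mulV (Matrix.fromCols M N) (dict Q x) = mulV M x + mulV N (Q x) := by
  simp only [mulV, dict, Matrix.fromCols_mulVec_sumElim, WithLp.toLp_add]

lemma mulV_jacobian (Q : Vec (Fin n) → Vec (Fin r)) (x w : Vec (Fin n)) :
    mulV (jacobian Q x) w = fderiv ℝ Q x w := by
  have hw : w = ∑ j, w j • EuclideanSpace.single j (1 : ℝ) := by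
    ext i
    simp [Finset.sum_apply, Pi.single_apply]
  conv_rhs => rw [hw]
  ext i
  simp [mulV, jacobian, Matrix.mulVec, dotProduct, mul_comm]

lemma norm_fderiv_apply_le {x : Vec (Fin n)}
    (hR : (R * Rᵀ - (jacobian Q x)ᵀ * jacobian Q x).PosSemidef) (w : Vec (Fin n)) :
    ‖fderiv ℝ Q x w‖ ≤ ‖mulV Rᵀ w‖ := by
  have h := posSemidef_mul_transpose_sub_iff (M := R) (N := (jacobian Q x)ᵀ)
  rw [Matrix.transpose_transpose] at h
  exact mulV_jacobian Q x w ▸ h.1 hR w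

lemma lipschitzWith_of_jacobian_le (hQ : Differentiable ℝ Q)
    (hR : ∀ x, (R * Rᵀ - (jacobian Q x)ᵀ * jacobian Q x).PosSemidef) :
    LipschitzWith ‖Rᵀ‖₊ Q :=
  lipschitzWith_of_nnnorm_fderiv_le hQ fun x =>
    ContinuousLinearMap.opNorm_le_bound _ (norm_nonneg _) fun w =>
      (norm_fderiv_apply_le (hR x) w).trans (Matrix.l2_opNorm_mulVec _ w)

lemma exists_inner_sub_eq_inner_fderiv {F G : Type*} [NormedAddCommGroup F] [NormedSpace ℝ F]
    [NormedAddCommGroup G] [InnerProductSpace ℝ G] {Q : F → G} (hQ : Differentiable ℝ Q) (p : G)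
    (x y : F) : ∃ z, ⟪p, Q x - Q y⟫ = ⟪p, fderiv ℝ Q z (x - y)⟫ := by
  obtain ⟨z, -, hz⟩ := domain_mvt (f := fun x => ⟪p, Q x⟫)
    (fun x _ => ((innerSL ℝ p).hasFDerivAt.comp x (hQ x).hasFDerivAt).hasFDerivWithinAt)
    convex_univ (mem_univ y) (mem_univ x)
  exact ⟨z, (inner_sub_right _ _ _).trans hz⟩

lemma exists_lipschitzWith_mulV_dict {ι : Type} [Fintype ι] (N : Matrix ι (Fin n ⊕ Fin r) ℝ)
    {K : ℝ≥0} (hQ : LipschitzWith K Q) : ∃ L, LipschitzWith L fun x => mulV N (dict Q x) := by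
  have hsplit : (fun x => mulV N (dict Q x)) = fun x => mulV N.toCols₁ x + mulV N.toCols₂ (Q x) :=
    funext fun x => by rw [← mulV_fromCols_dict, Matrix.fromCols_toCols]
  exact ⟨_, hsplit ▸ (lipschitzWith_mulV N.toCols₁).add ((lipschitzWith_mulV N.toCols₂).comp hQ)⟩

end Dictionary

section ClosedLoop

open scoped RealInnerProductSpace NNReal

variable {n m r q τ T : ℕ} {A : Matrix (Fin n) (Fin n ⊕ Fin r) ℝ} {B : Matrix (Fin n) (Fin m) ℝ}
  {E : Matrix (Fin n) (Fin q) ℝ} {Q : Vec (Fin n) → Vec (Fin r)}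
  {K : Matrix (Fin m) (Fin n ⊕ Fin r) ℝ} {d : ℝ → Vec (Fin q)}

lemma closedLoop_sub (t : ℝ) (x y : Vec (Fin n)) :
    closedLoop A B E Q K d t x - closedLoop A B E Q K d t y =
      mulV (A + B * K) (dict Q x) - mulV (A + B * K) (dict Q y) :=
  add_sub_add_right_eq_sub _ _ _

lemma exists_lipschitzWith_closedLoop {L : ℝ≥0} (hQ : LipschitzWith L Q) :
    ∃ C, ∀ t, LipschitzWith C (closedLoop A B E Q K d t) := by
  obtain ⟨C, hC⟩ := exists_lipschitzWith_mulV_dict (A + B * K) hQ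
  exact ⟨_, fun t => hC.add (LipschitzWith.const (mulV E (d t)))⟩

open scoped Matrix.Norms.L2Operator in
lemma continuous_closedLoop {L : ℝ≥0} (hQ : LipschitzWith L Q) (hd : Continuous d) :
    Continuous (Function.uncurry (closedLoop A B E Q K d)) := by
  obtain ⟨C, hC⟩ := exists_lipschitzWith_mulV_dict (A + B * K) hQ
  exact (hC.continuous.comp continuous_snd).add
    ((lipschitzWith_mulV E).continuous.comp (hd.comp continuous_fst))

open scoped Matrix.Norms.L2Operator in
lemma norm_closedLoop_zero_le {M : ℝ} (hd : ∀ t, ‖d t‖ ≤ M) (t : ℝ) :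
    ‖closedLoop A B E Q K d t 0‖ ≤ ‖mulV (A + B * K) (dict Q 0)‖ + ‖E‖ * M :=
  norm_add_le_of_le le_rfl ((Matrix.l2_opNorm_mulVec E (d t)).trans (by gcongr; exact hd t))

lemma closedLoop_periodic {θ : ℝ} (hd : Function.Periodic d θ) :
    Function.Periodic (closedLoop A B E Q K d) θ := fun t => by
  unfold closedLoop
  rw [hd t]

variable {X₁ : Matrix (Fin n) (Fin T) ℝ} {Z₀ : Matrix (Fin n ⊕ Fin r) (Fin T) ℝ}
  {U₀ : Matrix (Fin m) (Fin T) ℝ} {D₀ : Matrix (Fin q) (Fin T) ℝ}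
  {Δ : Matrix (Fin q) (Fin q) ℝ} {R : Matrix (Fin n) (Fin τ) ℝ} {P : Matrix (Fin n) (Fin n) ℝ}
  {Y₁ : Matrix (Fin T) (Fin n) ℝ} {G₂ : Matrix (Fin T) (Fin r) ℝ} {α μ : ℝ}

-- The mean value theorem replaces `Q x - Q y` by a value of the derivative of `Q` at `x - y`, to
-- which the Jacobian bound and hence the linear matrix inequality apply.
lemma inner_mulV_dict_sub_le (h : (-lmiMatrix X₁ E Δ R P Y₁ G₂ α μ).PosSemidef) (hμ : 0 ≤ μ)
    (hD : (Δ * Δᵀ - D₀ * D₀ᵀ).PosSemidef) (hP : IsUnit P) (hQ : Differentiable ℝ Q)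
    (hR : ∀ x, (R * Rᵀ - (jacobian Q x)ᵀ * jacobian Q x).PosSemidef) (x y : Vec (Fin n)) :
    ⟪mulV P⁻¹ (x - y),
      mulV ((X₁ - E * D₀) * Matrix.fromCols (Y₁ * P⁻¹) G₂) (dict Q x) -
        mulV ((X₁ - E * D₀) * Matrix.fromCols (Y₁ * P⁻¹) G₂) (dict Q y)⟫ ≤
      -(α / 2) * ‖mulV P⁻¹ (x - y)‖ ^ 2 := by
  set L := X₁ - E * D₀
  set u := mulV P⁻¹ (x - y) with hu
  have hxy : x - y = mulV P u := by
    rw [hu, ← mulV_mul, Matrix.mul_nonsing_inv _ ((Matrix.isUnit_iff_isUnit_det _).1 hP)]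
    simp [mulV]
  obtain ⟨z, hz⟩ := exists_inner_sub_eq_inner_fderiv hQ (mulV (L * G₂)ᵀ u) x y
  have hz' : ⟪u, mulV L (mulV G₂ (Q x - Q y))⟫ =
      ⟪u, mulV L (mulV G₂ (fderiv ℝ Q z (x - y)))⟫ := by
    rwa [← inner_mulV_right, ← inner_mulV_right, mulV_mul, mulV_mul] at hz
  have ha : ‖fderiv ℝ Q z (x - y)‖ ≤ ‖mulV Rᵀ (mulV P u)‖ :=
    hxy ▸ norm_fderiv_apply_le (hR z) (x - y)
  have hlmi := two_mul_inner_le_of_lmiMatrix h hμ hD ha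
  have hsplit : mulV (L * Matrix.fromCols (Y₁ * P⁻¹) G₂) (dict Q x) -
      mulV (L * Matrix.fromCols (Y₁ * P⁻¹) G₂) (dict Q y) =
      mulV L (mulV Y₁ u) + mulV L (mulV G₂ (Q x - Q y)) := by
    simp only [mulV_mul, mulV_fromCols_dict, mulV_add, mulV_sub, hu]
    abel
  rw [mulV_add, inner_add_right] at hlmi
  rw [hsplit, inner_add_right, hz']
  linarith

lemma exists_isIncrementallyISS_closedLoop (hQ : Differentiable ℝ Q)
    (hR : ∀ x, (R * Rᵀ - (jacobian Q x)ᵀ * jacobian Q x).PosSemidef)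
    (hdata : X₁ = A * Z₀ + B * U₀ + E * D₀) (hD : (Δ * Δᵀ - D₀ * D₀ᵀ).PosSemidef)
    (hSDP : IsFeasible X₁ Z₀ E Δ R P Y₁ G₂ α μ) (d : ℝ → Vec (Fin q)) :
    ∃ c l g, IsIncrementallyISS (closedLoop A B E Q (gain U₀ P Y₁ G₂) d) c l g := by
  let H := Matrix.toEuclideanCLM (𝕜 := ℝ) P⁻¹
  have hPinv : P⁻¹.PosDef := hSDP.posDef.inv
  obtain ⟨c, hc, hH⟩ : ∃ c : ℝ, 0 < c ∧ ∀ x, c * ‖x‖ ^ 2 ≤ ⟪H x, x⟫ :=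
    exists_pos_mul_norm_sq_le_inner fun x hx => by
      rw [real_inner_comm, Matrix.inner_toEuclideanCLM]
      exact hPinv.dotProduct_mulVec_pos (by simpa using hx)
  have hsymm : H.toLinearMap.IsSymmetric :=
    Matrix.isSymmetric_toEuclideanLin_iff.2 hPinv.isHermitian
  refine ⟨_, _, _, isIncrementallyISS_of_dissipation (β := α / 2) hsymm hc hH
    (half_pos hSDP.alpha_pos) fun t x y => ?_⟩
  rw [closedLoop_sub, add_mul_gain_eq hdata hSDP.posDef.isUnit hSDP.eq_left hSDP.eq_right]
  exact inner_mulV_dict_sub_le hSDP.lmi hSDP.mu_pos.le hD hSDP.posDef.isUnit hQ hR x y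

end ClosedLoop

end DataControl

theorem corollary3_general {n m r q τ T : ℕ} {A : Matrix (Fin n) (Fin n ⊕ Fin r) ℝ}
    {B : Matrix (Fin n) (Fin m) ℝ} {E : Matrix (Fin n) (Fin q) ℝ}
    {Q : Vec (Fin n) → Vec (Fin r)} (hQ : Differentiable ℝ Q) {R : Matrix (Fin n) (Fin τ) ℝ}
    (hR : ∀ x, (R * Rᵀ - (jacobian Q x)ᵀ * jacobian Q x).PosSemidef)
    {X₁ : Matrix (Fin n) (Fin T) ℝ} {Z₀ : Matrix (Fin n ⊕ Fin r) (Fin T) ℝ}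
    {U₀ : Matrix (Fin m) (Fin T) ℝ} {D₀ : Matrix (Fin q) (Fin T) ℝ}
    (hdata : X₁ = A * Z₀ + B * U₀ + E * D₀) {Δ : Matrix (Fin q) (Fin q) ℝ}
    (hD₀ : (Δ * Δᵀ - D₀ * D₀ᵀ).PosSemidef) {P : Matrix (Fin n) (Fin n) ℝ}
    {Y₁ : Matrix (Fin T) (Fin n) ℝ} {G₂ : Matrix (Fin T) (Fin r) ℝ} {α μ : ℝ}
    (hSDP : IsFeasible X₁ Z₀ E Δ R P Y₁ G₂ α μ) {K : Matrix (Fin m) (Fin n ⊕ Fin r) ℝ}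
    (hK : K = gain U₀ P Y₁ G₂) {d : ℝ → Vec (Fin q)} (hd : Continuous d)
    (hdM : ∃ M, ∀ t, ‖d t‖ ≤ M) :
    IsConvergent (closedLoop A B E Q K d) ∧
    ∀ xs : ℝ → Vec (Fin n), IsBoundedSolution (closedLoop A B E Q K d) xs →
      (∀ θ : ℝ, Function.Periodic d θ → Function.Periodic xs θ) ∧
      ((∃ d₀, ∀ t, d t = d₀) → ∃ x₀, ∀ t, xs t = x₀) ∧
      ∃ (βhat : ℝ → ℝ → ℝ) (γhat : ℝ → ℝ), IsClassKL βhat ∧ IsClassKInfty γhat ∧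
        ∀ w : ℝ → Vec (Fin n), ContinuousOn w (Ici 0) →
          ForwardCompleteFrom (fun t x => closedLoop A B E Q K d t x + w t) 0 ∧
          ∀ x : ℝ → Vec (Fin n),
            IsIntegralCurveOn x (fun t x => closedLoop A B E Q K d t x + w t) (Ici 0) →
            ∀ t : ℝ, 0 ≤ t →
              ‖x t - xs t‖ ≤ βhat ‖x 0 - xs 0‖ t +
                γhat (sSup ((fun σ => ‖w σ‖) '' Icc 0 t)) := by
  subst hK
  obtain ⟨M, hM⟩ := hdM
  obtain ⟨c, l, g, hv⟩ := exists_isIncrementallyISS_closedLoop hQ hR hdata hD₀ hSDP d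
  have hQL := lipschitzWith_of_jacobian_le hQ hR
  have hcont := continuous_closedLoop (A := A) (B := B) (E := E) (K := gain U₀ P Y₁ G₂) hQL hd
  obtain ⟨C, hC⟩ := exists_lipschitzWith_closedLoop (A := A) (B := B) (E := E)
    (K := gain U₀ P Y₁ G₂) (d := d) hQL
  refine ⟨hv.isConvergent hcont hC (norm_closedLoop_zero_le hM), fun xs hxs => ?_⟩
  have hper (θ : ℝ) (hθ : Function.Periodic d θ) : Function.Periodic xs θ :=
    hxs.periodic hv (closedLoop_periodic hθ)
  refine ⟨hper, fun ⟨d₀, hd₀⟩ => ⟨xs 0, fun t => ?_⟩, _, _,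
    isClassKL_mul_exp_neg_mul hv.overshoot_pos hv.rate_pos, isClassKInfty_const_mul hv.gain_pos,
    fun w hw => ⟨?_, fun x hx t ht => hv.norm_sub_le_add_sSup ht hw hx hxs.1⟩⟩
  · simpa using hper t (fun s => (hd₀ _).trans (hd₀ s).symm) 0
  · exact forwardCompleteFrom_of_lipschitzWith
      (hcont.continuousOn.add (hw.comp continuousOn_fst fun p hp => hp.1))
      fun t _ => (hC t).add (LipschitzWith.const (w t))

theorem corollary3
    {n m r q τ T : ℕ} (hT : 0 < T)
    -- the plant `ẋ = f(x) + B u + E d` with `f = A Z`, `Z(x) = [x; Q(x)]` continuously differentiable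
    (f : Vec (Fin n) → Vec (Fin n))
    (A : Matrix (Fin n) (Fin n ⊕ Fin r) ℝ) (B : Matrix (Fin n) (Fin m) ℝ)
    (E : Matrix (Fin n) (Fin q) ℝ)
    (Q : Vec (Fin n) → Vec (Fin r)) (hQ : ContDiff ℝ 1 Q)
    (hf : ∀ x, f x = mulV A (dict Q x))
    -- the bound on the Jacobian of `Q` on all of `ℝⁿ`
    (R : Matrix (Fin n) (Fin τ) ℝ)
    (hR : ∀ x, (R * Rᵀ - (jacobian Q x)ᵀ * jacobian Q x).PosSemidef)
    -- the data, with disturbance samples of norm at most `δ`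
    (δ : ℝ) (hδ : 0 < δ)
    (e : Experiment f B E T) (he : ∀ i, ‖e.disturbance (e.time i)‖ ≤ δ)
    -- a solution of the semidefinite program with `Δ = δ √T I`
    (P : Matrix (Fin n) (Fin n) ℝ) (Y₁ : Matrix (Fin T) (Fin n) ℝ)
    (G₂ : Matrix (Fin T) (Fin r) ℝ) (α μ : ℝ)
    (hSDP : IsFeasible e.X1 (e.Z0 Q) E ((δ * √(T : ℝ)) • (1 : Matrix (Fin q) (Fin q) ℝ)) R
      P Y₁ G₂ α μ)
    (K : Matrix (Fin m) (Fin n ⊕ Fin r) ℝ) (hK : K = gain e.U0 P Y₁ G₂)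
    -- the disturbance that acts on the closed loop
    (d : ℝ → Vec (Fin q)) (hd : Continuous d) (hdδ : ∀ t, ‖d t‖ ≤ δ) :
    IsConvergent (closedLoop A B E Q K d) ∧
    ∀ xs : ℝ → Vec (Fin n), IsBoundedSolution (closedLoop A B E Q K d) xs →
      (∀ θ : ℝ, 0 < θ → Function.Periodic d θ → Function.Periodic xs θ) ∧
      ((∃ d₀, ∀ t, d t = d₀) → ∃ x₀, ∀ t, xs t = x₀) ∧
      ∃ (βhat : ℝ → ℝ → ℝ) (γhat : ℝ → ℝ), IsClassKL βhat ∧ IsClassKInfty γhat ∧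
        ∀ w : ℝ → Vec (Fin n), ContinuousOn w (Ici 0) → (∃ C : ℝ, ∀ t, 0 ≤ t → ‖w t‖ ≤ C) →
          ForwardCompleteFrom (fun t x => closedLoop A B E Q K d t x + w t) 0 ∧
          ∀ x : ℝ → Vec (Fin n),
            IsIntegralCurveOn x (fun t x => closedLoop A B E Q K d t x + w t) (Ici 0) →
            ∀ t : ℝ, 0 ≤ t →
              ‖x t - xs t‖ ≤ βhat ‖x 0 - xs 0‖ t +
                γhat (sSup ((fun σ => ‖w σ‖) '' Icc 0 t)) := by
  obtain ⟨hconv, hsol⟩ := corollary3_general (hQ.differentiable one_ne_zero) hR (e.X1_eq hf)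
    (e.posSemidef_sub_D0 he) hSDP hK hd ⟨δ, hdδ⟩
  exact ⟨hconv, fun xs hxs =>
    let ⟨hper, hconst, βhat, γhat, hβ, hγ, hw⟩ := hsol xs hxs
    ⟨fun θ _ => hper θ, hconst, βhat, γhat, hβ, hγ, fun w hwc _ => hw w hwc⟩⟩
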